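/- Let $M$ be a compact $7$-manifold with a $3$-Sasakian structure $(g,(\alpha_p),(\mathsf J_p))_{p=1,2,3}$: an $\mathrm{Sp}(1)$-structure with Reeb fields $A_p=\alpha_p^\sharp$ such that the almost complex structures $I_p$ on the cone $(\mathbb R^+\times M, dr^2+r^2g)$ given by $I_pX=\mathsf J_pX-\alpha_p(X)\,r\partial_r$ ($X\in TM$), $I_p(r\partial_r)=A_p$, $I_1I_2=I_3$, form a hyperkähler structure. For $c\in\mathbb R^3$ put $A_c=\sum c_pA_p$, $\mathsf J_c=\sum c_p\mathsf J_p$. Let $X$ be the leaf space (a $4$-orbifold) of the foliation tangent to $\mathsf A=\mathrm{span}(A_1,A_2,A_3)$, let $\tau\colon Z\to X$ be its twistor space, whose points $[m,v]$ ($m\in M$, $v\in S^2\subset\mathbb R^3$) are the complex structures induced by $\mathsf J_v|_{\mathsf A^\perp}$ on $T_{[m]}X\cong\mathsf A^\perp_m$ (so $Z=(M\times S^2)/\mathrm{Sp}(1)$, where the action is generated by the vector fields $(A_c,\,2c\times v)$), and let $q\colon Z\times S^2\to X$ be $q(z,w)=\tau(z)$. Identify $(z,w)\in Z\times S^2$,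 $z=[m,w]$, with the Hopf circle through $m$ tangent to $A_w$. Fix $a,b>0$. At $([m,v],w)$ choose an oriented orthonormal basis $(e_1,e_2,e_3)$ of $\mathbb R^3$ with $e_1=v$, an oriented orthonormal basis $(h_1,h_2,h_3)$ with $h_1=w$, and an orthonormal coframe $\beta_1,\dots,\beta_4$ of $\mathsf A^\perp_m$ on which $g(\mathsf J_{e_1}\cdot,\cdot)$, $g(\mathsf J_{e_2}\cdot,\cdot)$, $g(\mathsf J_{e_3}\cdot,\cdot)$ equal $-\beta_{12}-\beta_{34}$, $-\beta_{13}+\beta_{24}$, $\beta_{14}+\beta_{23}$. Put $\zeta_2=\tfrac12\langle dw,h_3\rangle$, $\zeta_3=-\tfrac12\langle dw,h_2\rangle$ and $$\alpha_2=\langle\alpha,e_2\rangle+\tfrac12\langle dv,e_3\rangle-\zeta_2,\qquad \alpha_3=\langle\alpha,e_3\rangle-\tfrac12\langle dv,e_2\rangle-\zeta_3 ,$$ where $\alpha$ on the right is the $\mathbb R^3$-valued form $(\alpha_1,\alpha_2,\alpha_3)$ of $M$ (if $v=w$ and $e=h$ these are the forms $\langle\alpha,e_2\rangle,\langle\alpha,e_3\rangle$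 of $M$). The almost complex structure $J$ on $Z\times S^2$ is the one whose $(1,0)$-forms are spanned by $$\pi_1=a(\alpha_2+i\alpha_3),\quad \pi_2=\sqrt2\,b(\beta_1+i\beta_2),\quad \pi_3=\sqrt2\,b(\beta_3+i\beta_4),\quad \pi_4=\zeta_2+i\zeta_3 .$$ It does not depend on $a,b$ or on the choices. For $a=b=1$, restricting $J$ and the metric $\sum_k\pi_k\circ\bar\pi_k$ to a slice $Z\times\{w\}$ gives the (strict nearly Kähler) almost complex structure and metric of $Z$, independently of $w$; the horizontal distribution $\mathsf H\subset TZ$ is the orthogonal complement of the tangent spaces to the fibers of $\tau$. The sphere $S^2$ carries the complex structure $\eta\mapsto w\times\eta$ on $T_wS^2$. **Proposition.** Let $\Sigma$ be a smooth surface and $f\colon\Sigma\to Z$ a horizontal immersed pseudo-holomorphic curve, i.e. a smooth immersion (in the orbifold sense: smooth maps are those with smooth local lifts to $M\times S^2$) whose tangent planes lie in $\mathsf H$ and are invariant under the almost complex structure of $Z$. Equip $\Sigma$ with the complex structure induced by $f$, and let $w\colon\Sigma\to S^2$ be a holomorphic map. Then $(f,w)\colon\Sigma\to Z\times S^2$ is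 a $J$-holomorphic curve, i.e. a smooth immersion whose tangent planes are $J$-invariant, and it is nowhere tangent to the fibers of $q$: no nonzero tangent vector of $\Sigma$ is mapped by $d(f,w)$ to a vector tangent to a fiber of $q$. -/

import Mathlib

open scoped Manifold ContDiff

noncomputable section

namespace ThreeSasaki

/-! ## Two tensorial conditions on a manifold -/

section Tensors

variable {E H N : Type*} [NormedAddCommGroup E] [NormedSpace ℝ E] [TopologicalSpace H]
  [TopologicalSpace N] [ChartedSpace H N]

/-- A smooth vector field on `N`. -/
def SmoothField (I : ModelWithCorners ℝ E H) [IsManifold I ∞ N]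
    (X : ∀ x : N, TangentSpace I x) : Prop :=
  ContMDiff I I.tangent ∞ (fun x => (Bundle.TotalSpace.mk x (X x) : TangentBundle I N))

/-- The derivative `X(h)` at `x` of a function `h` along a vector field `X`. -/
def dirDeriv (I : ModelWithCorners ℝ E H) (X : ∀ x : N, TangentSpace I x) (h : N → ℝ)
    (x : N) : ℝ :=
  (mfderiv I 𝓘(ℝ, ℝ) h x (X x) : ℝ)

/-- `dκ = 0` for a smooth 2-form `κ`, where `dκ` is given by the invariant formula. -/
def ClosedTwoForm (I : ModelWithCorners ℝ E H) [IsManifold I ∞ N]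
    (κ : ∀ x : N, TangentSpace I x → TangentSpace I x → ℝ) : Prop :=
  ∀ X Y Z : ∀ x : N, TangentSpace I x,
    SmoothField I X → SmoothField I Y → SmoothField I Z → ∀ x : N,
      dirDeriv I X (fun y => κ y (Y y) (Z y)) x
        - dirDeriv I Y (fun y => κ y (X y) (Z y)) x
        + dirDeriv I Z (fun y => κ y (X y) (Y y)) x
        - κ x (VectorField.mlieBracket I X Y x) (Z x)
        + κ x (VectorField.mlieBracket I X Z x) (Y x)
        - κ x (VectorField.mlieBracket I Y Z x) (X x) = 0

/-- Vanishing of the Nijenhuis tensor of a smooth almost complex structure. -/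
def IntegrableACS (I : ModelWithCorners ℝ E H) [IsManifold I ∞ N]
    (K : ∀ x : N, TangentSpace I x → TangentSpace I x) : Prop :=
  ∀ X Y : ∀ x : N, TangentSpace I x, SmoothField I X → SmoothField I Y → ∀ x : N,
    VectorField.mlieBracket I (fun y => K y (X y)) (fun y => K y (Y y)) x
      - K x (VectorField.mlieBracket I (fun y => K y (X y)) Y x)
      - K x (VectorField.mlieBracket I X (fun y => K y (Y y)) x)
      - VectorField.mlieBracket I X Y x = 0

end Tensors

/-! ## Euclidean 3-space and the 2-sphere -/

/-- Euclidean 3-space. -/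
abbrev E3 : Type := EuclideanSpace ℝ (Fin 3)

/-- The unit sphere `S² ⊂ ℝ³`. -/
abbrev S2 : Type := Metric.sphere (0 : E3) 1

/-- The cross product of `ℝ³`. -/
def cross (u v : E3) : E3 := WithLp.toLp 2 (crossProduct (WithLp.ofLp u) (WithLp.ofLp v))

/-- `(e 0, e 1, e 2)` is a positively oriented orthonormal basis of `ℝ³`. -/
def OrientedFrame (e : Fin 3 → E3) : Prop :=
  Orthonormal ℝ e ∧ e 2 = cross (e 0) (e 1)

/-! ## Sp(1)-structures and 3-Sasakian structures on 7-manifolds -/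

section Structures

variable (M : Type*) [TopologicalSpace M] [ChartedSpace (EuclideanSpace ℝ (Fin 7)) M]
  [IsManifold (𝓡 7) ∞ M]

/-- An `Sp(1)`-structure on a 7-manifold: a Riemannian metric `g` and three almost contact metric
structures `(g, α_p, J_p)` with Reeb fields `A_p`, `α_p = g(A_p, ·)`, satisfying the quaternionic
relations. The index `p : Fin 3` is cyclic. The signs are those for which
the associated almost complex structures `I_p` on the cone satisfy `I_1 I_2 = I_3`. -/
structure Sp1Structure where
  /-- the Riemannian metric -/
  g : Bundle.ContMDiffRiemannianMetric (𝓡 7) ∞ (EuclideanSpace ℝ (Fin 7))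
    (fun x : M => TangentSpace (𝓡 7) x)
  /-- the Reeb fields -/
  A : Fin 3 → ∀ x : M, TangentSpace (𝓡 7) x
  /-- the endomorphisms -/
  J : Fin 3 → ∀ x : M, TangentSpace (𝓡 7) x →L[ℝ] TangentSpace (𝓡 7) x
  smooth_A : ∀ p, SmoothField (𝓡 7) (A p)
  smooth_J : ∀ p (X : ∀ x : M, TangentSpace (𝓡 7) x), SmoothField (𝓡 7) X →
    SmoothField (𝓡 7) (fun x => J p x (X x))
  unit_A : ∀ p x, g.inner x (A p x) (A p x) = 1
  J_A : ∀ p x, J p x (A p x) = 0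
  metric_J : ∀ p x (X Y : TangentSpace (𝓡 7) x),
    g.inner x (J p x X) (J p x Y) = g.inner x X Y - g.inner x (A p x) X * g.inner x (A p x) Y
  J_sq : ∀ p x (X : TangentSpace (𝓡 7) x),
    J p x (J p x X) = -X + g.inner x (A p x) X • A p x
  J_mul : ∀ p x (X : TangentSpace (𝓡 7) x),
    J p x (J (p + 1) x X) = J (p + 2) x X + g.inner x (A (p + 1) x) X • A p x
  J_mul' : ∀ p x (X : TangentSpace (𝓡 7) x),
    J (p + 1) x (J p x X) = -J (p + 2) x X + g.inner x (A p x) X • A (p + 1) x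
  J_A_succ : ∀ p x, J p x (A (p + 1) x) = A (p + 2) x
  J_A_pred : ∀ p x, J (p + 1) x (A p x) = -A (p + 2) x

/-- The half-line `(0, ∞)`. -/
abbrev PosReal : TopologicalSpace.Opens ℝ := ⟨Set.Ioi 0, isOpen_Ioi⟩

/-- The model with corners of the cone `C(M) = (0, ∞) × M`. -/
abbrev coneModel := (𝓘(ℝ, ℝ)).prod (𝓡 7)

variable {M}

/-- The almost complex structure `I_p` of the cone, `I_p X = J_p X - α_p(X) r ∂_r` for `X ∈ TM`
and `I_p (r ∂_r) = A_p`. The pair `(s, X)` stands for `s ∂_r + X`. -/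
def Sp1Structure.coneI (S : Sp1Structure M) (p : Fin 3) (y : PosReal × M)
    (u : TangentSpace coneModel y) : TangentSpace coneModel y :=
  let s : ℝ := u.1
  let X : TangentSpace (𝓡 7) y.2 := u.2
  let r : ℝ := (y.1 : ℝ)
  ((-(r * S.g.inner y.2 (S.A p y.2) X), S.J p y.2 X + (s / r) • S.A p y.2) :
    ℝ × TangentSpace (𝓡 7) y.2)

/-- The cone metric `dr² + r² g`. -/
def Sp1Structure.coneMetric (S : Sp1Structure M) (y : PosReal × M)
    (u u' : TangentSpace coneModel y) : ℝ :=
  let s : ℝ := u.1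
  let X : TangentSpace (𝓡 7) y.2 := u.2
  let s' : ℝ := u'.1
  let X' : TangentSpace (𝓡 7) y.2 := u'.2
  s * s' + (y.1 : ℝ) ^ 2 * S.g.inner y.2 X X'

variable (M)

/-- A 3-Sasakian structure: an `Sp(1)`-structure for which the induced `Sp(2)`-structure on the
metric cone is hyperkähler, i.e. each `I_p` is integrable and each Kähler form
`ω_p = g_C(I_p ·, ·)` is closed. -/
structure Structure extends Sp1Structure M where
  integrable : ∀ p, IntegrableACS coneModel (toSp1Structure.coneI p)
  closed : ∀ p, ClosedTwoForm coneModel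
    (fun y u u' => toSp1Structure.coneMetric y (toSp1Structure.coneI p y u) u')

end Structures

namespace Structure

variable {M : Type*} [TopologicalSpace M] [ChartedSpace (EuclideanSpace ℝ (Fin 7)) M]
  [IsManifold (𝓡 7) ∞ M] (S : Structure M)

/-- The 1-form `α_c = ∑ c_p α_p` for `c ∈ ℝ³`. -/
def alpha (c : E3) (m : M) (X : TangentSpace (𝓡 7) m) : ℝ :=
  ∑ p, c p * S.g.inner m (S.A p m) X

/-- The vector field `A_c = ∑ c_p A_p` for `c ∈ ℝ³`; for `c ∈ S²` it is a Reeb field. -/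
def reeb (c : E3) (m : M) : TangentSpace (𝓡 7) m := ∑ p, c p • S.A p m

/-- The 2-form `Ω_c(X, Y) = g(J_c X, Y)`, where `J_c = ∑ c_p J_p`. -/
def Omega (c : E3) (m : M) (X Y : TangentSpace (𝓡 7) m) : ℝ :=
  ∑ p, c p * S.g.inner m (S.J p m X) Y

/-! ## The orbifolds `X`, `Z` and `Z × S²`

On a compact `M` the Reeb fields are complete and integrate to a locally free action of `Sp(1)`,
whose orbits are the canonical leaves (the integral manifolds of `span(A_1, A_2, A_3)`). Any two
points of an orbit are joined by an orbit of a one-parameter subgroup, that is, by an integral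
curve of some `A_c`. -/

/-- The leaf space `X` of the canonical foliation. -/
def LeafSpace : Type _ :=
  Quot (fun m m' : M => ∃ (c : E3) (γ : ℝ → M),
    IsMIntegralCurve (I := 𝓡 7) γ (S.reeb c) ∧ γ 0 = m ∧ γ 1 = m')

/-- The twistor space `Z` of `X`. The pair `(m, v) ∈ M × S²` represents the point of `Z` over the
leaf of `m` given by the complex structure that `J_v` induces on
`ker(α_1, α_2, α_3) ⊂ T_m M ≅ T_{[m]} X`. Since `L_{A_1} Ω_2 = -2 Ω_3`, etc., on this kernel, the
complex structure on `T_{[m]} X` is unchanged when `m` moves along the flow of `A_c` and `v`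
satisfies `v' = 2 c × v`; so `Z` is the quotient of `M × S²` by this diagonal `Sp(1)`-action.
For fixed `v`, the map `m ↦ [m, v]` identifies the space `M / F_v` of leaves of the Reeb field
`A_v` with `Z`. -/
def TwistorSpace : Type _ :=
  Quot (fun z z' : M × S2 => ∃ (c : E3) (γ : ℝ → M) (u : ℝ → E3),
    IsMIntegralCurve (I := 𝓡 7) γ (S.reeb c) ∧ γ 0 = z.1 ∧ γ 1 = z'.1 ∧
    (∀ t, HasDerivAt u ((2 : ℝ) • cross c (u t)) t) ∧ u 0 = z.2 ∧ u 1 = z'.2)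

/-- The projection `M × S² → Z`. -/
def twistorMk (m : M) (v : S2) : S.TwistorSpace := Quot.mk _ (m, v)

/-- The twistor projection `τ : Z → X`. -/
def tau : S.TwistorSpace → S.LeafSpace :=
  Quot.map Prod.fst (by
    rintro z z' ⟨c, γ, u, hγ, h0, h1, -⟩
    exact ⟨c, γ, hγ, h0, h1⟩)

/-- The bundle `q : Z × S² → X`. The point `([m, w], w)` of `Z × S²` stands for the Hopf circle
through `m` with velocity `A_w`, and every point of `Z × S²` is of this form. -/
def q (y : S.TwistorSpace × S2) : S.LeafSpace := S.tau y.1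

/-! ## Tangent vectors of the orbifolds

A tangent vector of `Z` at `[m, v]` is represented by a pair `(X, ν)` with `X ∈ T_m M` and
`ν ∈ T_v S² ⊂ ℝ³`, modulo the directions of the orbits of `Sp(1)`; a tangent vector of `Z × S²` at
`([m, v], w)` by a triple `(X, ν, η)` with, in addition, `η ∈ T_w S² ⊂ ℝ³`. -/

/-- The pair `(X, ν)` represents the zero vector of `T_{[m, v]} Z`: it is tangent to the orbit of
`(m, v)`. -/
def IsZeroZ (m : M) (v : S2) (t : TangentSpace (𝓡 7) m × E3) : Prop :=
  ∃ c : E3, t.1 = S.reeb c m ∧ t.2 = (2 : ℝ) • cross c v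

/-- `X` is tangent to the canonical leaf through `m`; equivalently, the vectors `(X, ν)` at
`[m, v]` and `(X, ν, η)` at `([m, v], w)` are in the kernel of `dτ` and of `dq`,
i.e. are tangent to the fibers of `τ` and of `q`. -/
def IsVertical (m : M) (X : TangentSpace (𝓡 7) m) : Prop :=
  ∃ c : E3, X = S.reeb c m

/-- An `SO(4)`-frame at `m`: an oriented orthonormal frame `A_{e 0}, A_{e 1}, A_{e 2}` of
`span(A_1, A_2, A_3)` and an orthonormal frame `b 0, …, b 3` of its orthogonal complement,
such that, in the dual coframe `(α_1, α_2, α_3, β_1, …, β_4)`,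
`Ω_{e 0} = α_2 ∧ α_3 - β_1 ∧ β_2 - β_3 ∧ β_4`,
`Ω_{e 1} = α_3 ∧ α_1 - β_1 ∧ β_3 + β_2 ∧ β_4`,
`Ω_{e 2} = α_1 ∧ α_2 + β_1 ∧ β_4 + β_2 ∧ β_3`. -/
structure SO4Frame (m : M) where
  /-- the coefficients of the first three vectors with respect to the Reeb fields -/
  e : Fin 3 → E3
  /-- the last four vectors -/
  b : Fin 4 → TangentSpace (𝓡 7) m
  oriented : OrientedFrame e
  orthonormal : ∀ i k, S.g.inner m (b i) (b k) = if i = k then 1 else 0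
  transverse : ∀ i p, S.g.inner m (S.A p m) (b i) = 0
  Omega_one : ∀ X Y : TangentSpace (𝓡 7) m, S.Omega (e 0) m X Y =
    (S.alpha (e 1) m X * S.alpha (e 2) m Y - S.alpha (e 2) m X * S.alpha (e 1) m Y)
    - (S.g.inner m (b 0) X * S.g.inner m (b 1) Y - S.g.inner m (b 1) X * S.g.inner m (b 0) Y)
    - (S.g.inner m (b 2) X * S.g.inner m (b 3) Y - S.g.inner m (b 3) X * S.g.inner m (b 2) Y)
  Omega_two : ∀ X Y : TangentSpace (𝓡 7) m, S.Omega (e 1) m X Y =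
    (S.alpha (e 2) m X * S.alpha (e 0) m Y - S.alpha (e 0) m X * S.alpha (e 2) m Y)
    - (S.g.inner m (b 0) X * S.g.inner m (b 2) Y - S.g.inner m (b 2) X * S.g.inner m (b 0) Y)
    + (S.g.inner m (b 1) X * S.g.inner m (b 3) Y - S.g.inner m (b 3) X * S.g.inner m (b 1) Y)
  Omega_three : ∀ X Y : TangentSpace (𝓡 7) m, S.Omega (e 2) m X Y =
    (S.alpha (e 0) m X * S.alpha (e 1) m Y - S.alpha (e 1) m X * S.alpha (e 0) m Y)
    + (S.g.inner m (b 0) X * S.g.inner m (b 3) Y - S.g.inner m (b 3) X * S.g.inner m (b 0) Y)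
    + (S.g.inner m (b 1) X * S.g.inner m (b 2) Y - S.g.inner m (b 2) X * S.g.inner m (b 1) Y)

variable {S}

/-- For an oriented orthonormal frame `h` of `ℝ³` with `h 0 = w`, the pair `(ζ_2, ζ_3)` of
components of the left-invariant Maurer-Cartan form
of `SO(3)`, `dh = -[2ζ] h`, on a tangent vector along which `dw = η`:
`ζ_2 = ⟨dw, h 2⟩ / 2` and `ζ_3 = -⟨dw, h 1⟩ / 2`. -/
def zeta (h : Fin 3 → E3) (η : E3) : ℝ × ℝ :=
  (inner ℝ η (h 2) / 2, -(inner ℝ η (h 1) / 2))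

/-- The components `α_2, α_3` on the vector `(X, ν, η)`, for an
`SO(4)`-frame at `m` with `e 0 = v` and a frame `h` with `h 0 = w`. The components of index `2, 3`
of the `Λ²₊`-part `ψ` of the Levi-Civita form of `X` are `α_{e 1}(X) + ζ_2(ν)` and
`α_{e 2}(X) + ζ_3(ν)`, where `ζ(ν)` is computed with the frame `e`, and `α = ψ - ζ(η)`. Where
`v = w` and `e = h`, so that the Hopf circle passes through `m`, one gets back the forms
`α_{e 1}` and `α_{e 2}` of `M`. -/
def alphaTwoThree {m : M} (F : S.SO4Frame m) (h : Fin 3 → E3)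
    (X : TangentSpace (𝓡 7) m) (ν η : E3) : ℝ × ℝ :=
  (S.alpha (F.e 1) m X + (zeta F.e ν).1 - (zeta h η).1,
   S.alpha (F.e 2) m X + (zeta F.e ν).2 - (zeta h η).2)

/-- The complex 1-forms `π_1 = μ_2 + i μ_3`, `π_2 = √2 (θ_1 + i θ_2)`, `π_3 = √2 (θ_3 + i θ_4)`,
`π_4 = ζ_2 + i ζ_3` on the vector `(X, ν, η)`, where `μ = a α` and `θ = b β`. -/
def piForm (a b : ℝ) {m : M} (F : S.SO4Frame m) (h : Fin 3 → E3)
    (X : TangentSpace (𝓡 7) m) (ν η : E3) : Fin 4 → ℂ :=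
  ![(a * (alphaTwoThree F h X ν η).1 : ℝ) + (a * (alphaTwoThree F h X ν η).2 : ℝ) * Complex.I,
    (Real.sqrt 2 : ℝ) * ((b * S.g.inner m (F.b 0) X : ℝ)
      + (b * S.g.inner m (F.b 1) X : ℝ) * Complex.I),
    (Real.sqrt 2 : ℝ) * ((b * S.g.inner m (F.b 2) X : ℝ)
      + (b * S.g.inner m (F.b 3) X : ℝ) * Complex.I),
    ((zeta h η).1 : ℝ) + ((zeta h η).2 : ℝ) * Complex.I]

variable (S)

/-- `t'` represents the image under the almost complex structure `J` of `Z × S²` of the tangent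
vector represented by `t`, at the point `([m, v], w)`: the forms `π_k`, which span
the `(1,0)`-forms, satisfy `π_k(t') = i π_k(t)`. -/
def JImage (a b : ℝ) (m : M) (v w : S2) (t t' : TangentSpace (𝓡 7) m × E3 × E3) : Prop :=
  ∀ (F : S.SO4Frame m) (h : Fin 3 → E3), F.e 0 = v → OrientedFrame h → h 0 = w →
    ∀ k : Fin 4, piForm a b F h t'.1 t'.2.1 t'.2.2 k =
      Complex.I * piForm a b F h t.1 t.2.1 t.2.2 k

/-- `t'` represents the image of the vector represented by `t` under the almost complex structure
of the strict nearly Kähler structure of `Z`, at `[m, v]`. This structure is the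
restriction of `J` (and of the metric below) to any slice `Z × {w}`, with `a = b = 1`; there
`ζ = 0` and `(1,0)`-forms are spanned by `π_1, π_2, π_3`. -/
def NKImage (m : M) (v : S2) (t t' : TangentSpace (𝓡 7) m × E3) : Prop :=
  ∀ w : S2, S.JImage 1 1 m v w (t.1, t.2, 0) (t'.1, t'.2, 0)

variable {S}

/-- The nearly Kähler metric `π_1 ∘ π̄_1 + π_2 ∘ π̄_2 + π_3 ∘ π̄_3` of `Z`, in terms of a frame
adapted to the point `[m, v]`. -/
def nkMetric {m : M} (F : S.SO4Frame m) (t t' : TangentSpace (𝓡 7) m × E3) : ℝ :=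
  ∑ k : Fin 3, (piForm 1 1 F F.e t.1 t.2 0 k.castSucc *
    (starRingEnd ℂ) (piForm 1 1 F F.e t'.1 t'.2 0 k.castSucc)).re

variable (S)

/-- `t` represents a vector of the horizontal distribution of `Z`: it is orthogonal, for the nearly
Kähler metric, to the tangent spaces of the fibers of `τ`. -/
def IsHorizontalVector (m : M) (v : S2) (t : TangentSpace (𝓡 7) m × E3) : Prop :=
  ∀ F : S.SO4Frame m, F.e 0 = v → ∀ t' : TangentSpace (𝓡 7) m × E3,
    inner ℝ (v : E3) t'.2 = 0 → S.IsVertical m t'.1 → nkMetric F t t' = 0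

/-! ## Maps from surfaces -/

section Maps

variable {C : Type*} [TopologicalSpace C] [ChartedSpace (EuclideanSpace ℝ (Fin 2)) C]

/-- `(Φ, v)` is a smooth local lift of `f : C → Z` to `M × S²`, on the open set `U`. -/
def IsLift (f : C → S.TwistorSpace) (U : Set C) (Φ : C → M) (v : C → S2) : Prop :=
  IsOpen U ∧ ContMDiffOn (𝓡 2) (𝓡 7) ∞ Φ U ∧ ContMDiffOn (𝓡 2) (𝓡 2) ∞ v U ∧
    ∀ s ∈ U, f s = S.twistorMk (Φ s) (v s)

/-- A smooth map from a manifold to the orbifold `Z` is one that has smooth local lifts to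
`M × S²`. -/
def IsSmooth (f : C → S.TwistorSpace) : Prop :=
  ∀ s : C, ∃ (U : Set C) (Φ : C → M) (v : C → S2), s ∈ U ∧ S.IsLift f U Φ v

/-- The differential of a map to `S²`, with values in `ℝ³`. -/
def sphereDeriv (w : C → S2) (s : C) (ξ : TangentSpace (𝓡 2) s) : E3 :=
  (mfderiv (𝓡 2) 𝓘(ℝ, E3) (fun x => (w x : E3)) s ξ : E3)

/-- The tangent vector of `Z` at `f s` that represents `df(ξ)` in the lift `(Φ, v)` of `f`. -/
def liftDeriv (Φ : C → M) (v : C → S2) (s : C) (ξ : TangentSpace (𝓡 2) s) :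
    TangentSpace (𝓡 7) (Φ s) × E3 :=
  (mfderiv (𝓡 2) (𝓡 7) Φ s ξ, sphereDeriv v s ξ)

/-- `f : C → Z` is an immersion: it is smooth and `df(ξ) ≠ 0` for `ξ ≠ 0`.

Here and below, whether a condition on `df` holds at `s` does not depend on the smooth local lift
that is used to compute `df`. -/
def IsImmersion (f : C → S.TwistorSpace) : Prop :=
  S.IsSmooth f ∧ ∀ U Φ v, S.IsLift f U Φ v → ∀ s ∈ U, ∀ ξ : TangentSpace (𝓡 2) s,
    S.IsZeroZ (Φ s) (v s) (liftDeriv Φ v s ξ) → ξ = 0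

/-- `f : C → Z` is an immersed pseudo-holomorphic curve for the nearly Kähler structure: an
immersion whose tangent planes are invariant under the almost complex structure. -/
def IsImmersedPseudoholomorphicCurve (f : C → S.TwistorSpace) : Prop :=
  S.IsImmersion f ∧ ∀ U Φ v, S.IsLift f U Φ v → ∀ s ∈ U, ∀ ξ : TangentSpace (𝓡 2) s,
    ∃ ξ' : TangentSpace (𝓡 2) s,
      S.NKImage (Φ s) (v s) (liftDeriv Φ v s ξ) (liftDeriv Φ v s ξ')

/-- `f : C → Z` is horizontal: its tangent planes lie in the horizontal distribution. -/
def IsHorizontal (f : C → S.TwistorSpace) : Prop :=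
  ∀ U Φ v, S.IsLift f U Φ v → ∀ s ∈ U, ∀ ξ : TangentSpace (𝓡 2) s,
    S.IsHorizontalVector (Φ s) (v s) (liftDeriv Φ v s ξ)

/-- `j` is the complex structure on `C` induced by the immersed pseudo-holomorphic curve `f`, that
is, `df(j ξ)` is the image of `df(ξ)` under the almost complex structure of `Z`. -/
def IsInducedComplexStructure (f : C → S.TwistorSpace)
    (j : ∀ s : C, TangentSpace (𝓡 2) s →L[ℝ] TangentSpace (𝓡 2) s) : Prop :=
  ∀ U Φ v, S.IsLift f U Φ v → ∀ s ∈ U, ∀ ξ : TangentSpace (𝓡 2) s,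
    S.NKImage (Φ s) (v s) (liftDeriv Φ v s ξ) (liftDeriv Φ v s (j s ξ))

/-- `w : (C, j) → S²` is holomorphic. The complex structure of `S²` at `w` is `η ↦ w × η`. -/
def IsHolomorphicToSphere
    (j : ∀ s : C, TangentSpace (𝓡 2) s →L[ℝ] TangentSpace (𝓡 2) s) (w : C → S2) : Prop :=
  ContMDiff (𝓡 2) (𝓡 2) ∞ w ∧ ∀ (s : C) (ξ : TangentSpace (𝓡 2) s),
    sphereDeriv w s (j s ξ) = cross (w s) (sphereDeriv w s ξ)

/-- `V : C → Z × S²` is a `J`-holomorphic curve: a smooth immersion each of whose tangent planes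
is `J`-invariant. -/
def IsJHolomorphicCurve (a b : ℝ) (V : C → S.TwistorSpace × S2) : Prop :=
  S.IsSmooth (fun s => (V s).1) ∧ ContMDiff (𝓡 2) (𝓡 2) ∞ (fun s => (V s).2) ∧
  ∀ U Φ v, S.IsLift (fun s => (V s).1) U Φ v → ∀ s ∈ U, ∀ ξ : TangentSpace (𝓡 2) s,
    (S.IsZeroZ (Φ s) (v s) (liftDeriv Φ v s ξ) ∧ sphereDeriv (fun s => (V s).2) s ξ = 0 → ξ = 0) ∧
    ∃ ξ' : TangentSpace (𝓡 2) s, S.JImage a b (Φ s) (v s) (V s).2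
      ((liftDeriv Φ v s ξ).1, (liftDeriv Φ v s ξ).2, sphereDeriv (fun s => (V s).2) s ξ)
      ((liftDeriv Φ v s ξ').1, (liftDeriv Φ v s ξ').2, sphereDeriv (fun s => (V s).2) s ξ')

/-- `V : C → Z × S²` is nowhere tangent to the fibers of `q`: no nonzero tangent vector of `C` is
mapped by `dV` to a vector that is tangent to a fiber of `q`. -/
def NowhereTangentToFibers (V : C → S.TwistorSpace × S2) : Prop :=
  ∀ U Φ v, S.IsLift (fun s => (V s).1) U Φ v → ∀ s ∈ U, ∀ ξ : TangentSpace (𝓡 2) s,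
    S.IsVertical (Φ s) (liftDeriv Φ v s ξ).1 → ξ = 0

end Maps

end Structure

end ThreeSasaki

end

/-!
Let `(X, ν)` represent a tangent vector of `Z` at `[m, v]`, and let `w : Σ → S²` be holomorphic,
with `η = dw(ξ)`.

The forms `π_2, π_3` are, up to the factor `b`, forms of `Z`, so they satisfy
`π_k(dV(jξ)) = i π_k(dV(ξ))` because `f` is pseudo-holomorphic; and `π_4` does because `w` is
holomorphic (`OrientedFrame.zeta_cross`). A horizontal vector is annihilated by the restrictions
to `Z` of `α_2` and `α_3` (`IsHorizontalVector.alpha_add_zeta`), so on vectors `(X, ν, η)` with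
`(X, ν)` horizontal `π_1 = -a π_4`, and the condition on `π_1` follows from the one on `π_4`.
This gives the `J`-invariance of the tangent planes (`NKImage.jImage`). The map `(f, w)` is an
immersion because `f` is.

A tangent vector of the curve that is tangent to a fiber of `q` has a first component which is both
horizontal and tangent to a fiber of `τ`, hence zero (`IsHorizontalVector.isZeroZ`). Since
horizontality is a condition on adapted frames, this uses that there is one over every point of `Z`
(`Structure.exists_SO4Frame`), which holds because the `J_c` multiply as imaginary quaternions on
the orthogonal complement of the Reeb fields.
-/

namespace ThreeSasaki

/-! ### The cross product and oriented frames of `ℝ³` -/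

theorem cross_self_zero (u : E3) : cross u u = 0 := by
  simp [cross]

/-- `v ↦ cross u v` is skew-symmetric. -/
theorem inner_cross_right (u v x : E3) : inner ℝ (cross u v) x = -inner ℝ v (cross u x) := by
  simp only [cross, PiLp.inner_apply, Fin.sum_univ_three, cross_apply, RCLike.inner_apply,
    Matrix.cons_val_zero, Matrix.cons_val_one, Matrix.cons_val, conj_trivial]
  ring

theorem cross_cross (u v x : E3) :
    cross u (cross v x) = inner ℝ u x • v - inner ℝ u v • x := by
  ext i
  fin_cases i <;>
  · simp [cross, PiLp.inner_apply, Fin.sum_univ_three, cross_apply]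
    ring

theorem cross_swap (u v : E3) : cross u v = -cross v u := by
  ext i
  fin_cases i <;>
  · simp [cross, cross_apply]
    ring

theorem inner_cross_self (u v : E3) : inner ℝ u (cross u v) = 0 := by
  have h := inner_cross_right u u v
  rw [cross_self_zero, inner_zero_left] at h
  linarith

theorem inner_cross_cross (u v : E3) (h : inner ℝ u v = 0) :
    inner ℝ (cross u v) (cross u v) = inner ℝ u u * inner ℝ v v := by
  rw [inner_cross_right, cross_cross, h, inner_sub_right, inner_smul_right, inner_smul_right]
  ring

namespace OrientedFrame

variable {e : Fin 3 → E3}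

theorem inner_eq (he : OrientedFrame e) (i k : Fin 3) :
    inner ℝ (e i) (e k) = if i = k then (1 : ℝ) else 0 :=
  orthonormal_iff_ite.1 he.1 i k

theorem cross_zero_one (he : OrientedFrame e) : cross (e 0) (e 1) = e 2 := he.2.symm

theorem cross_zero_two (he : OrientedFrame e) : cross (e 0) (e 2) = -e 1 := by
  rw [he.2, cross_cross, he.inner_eq, he.inner_eq]
  simp

theorem cross_one_two (he : OrientedFrame e) : cross (e 1) (e 2) = e 0 := by
  rw [he.2, cross_cross, he.inner_eq, he.inner_eq]
  simp

theorem ext_inner (he : OrientedFrame e) {x y : E3}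
    (h : ∀ i, inner ℝ (e i) x = inner ℝ (e i) y) : x = y := by
  have hc : Fintype.card (Fin 3) = Module.finrank ℝ E3 := by simp
  refine InnerProductSpace.ext_inner_left_basis (basisOfOrthonormalOfCardEqFinrank he.1 hc)
    fun i => ?_
  simpa using h i

end OrientedFrame

theorem exists_orientedFrame (v : S2) : ∃ e : Fin 3 → E3, OrientedFrame e ∧ e 0 = v := by
  have hv : ‖(v : E3)‖ = 1 := by simp
  have hk : LinearMap.ker (innerSL ℝ (v : E3) : E3 →ₗ[ℝ] ℝ) ≠ ⊥ :=
    LinearMap.ker_ne_bot_of_finrank_lt (by simp)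
  obtain ⟨x, hx, hx0⟩ := Submodule.exists_mem_ne_zero_of_ne_bot hk
  have hvx : inner ℝ (v : E3) x = 0 := by simpa using hx
  have hn : ‖x‖ ≠ 0 := by simpa using hx0
  set u : E3 := ‖x‖⁻¹ • x with hu
  have huu : inner ℝ u u = (1 : ℝ) := by
    rw [hu, inner_smul_left, inner_smul_right, real_inner_self_eq_norm_sq]
    simp only [conj_trivial]
    field_simp
  have hvu : inner ℝ (v : E3) u = (0 : ℝ) := by
    rw [hu, inner_smul_right, hvx, mul_zero]
  have hvv : inner ℝ (v : E3) v = (1 : ℝ) := by rw [real_inner_self_eq_norm_sq, hv]; norm_num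
  have h1 : inner ℝ (v : E3) (cross v u) = (0 : ℝ) := inner_cross_self _ _
  have h2 : inner ℝ u (cross v u) = (0 : ℝ) := by
    rw [cross_swap, inner_neg_right, inner_cross_self, neg_zero]
  have h3 : inner ℝ (cross v u) (cross v u) = (1 : ℝ) := by
    rw [inner_cross_cross _ _ hvu, hvv, huu, one_mul]
  refine ⟨![v, u, cross v u], ⟨orthonormal_iff_ite.2 fun i k => ?_, rfl⟩, rfl⟩
  fin_cases i <;> fin_cases k <;>
    simp [hvu, hvv, huu, h1, h2, h3, real_inner_comm, -inner_self_eq_norm_sq_to_K]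

/-! ### Algebra of the Reeb fields and of the endomorphisms `J_c` -/

namespace Structure

variable {M : Type*} [TopologicalSpace M] [ChartedSpace (EuclideanSpace ℝ (Fin 7)) M]
  [IsManifold (𝓡 7) ∞ M] (S : Structure M)

theorem g_symm (m : M) (X Y : TangentSpace (𝓡 7) m) : S.g.inner m X Y = S.g.inner m Y X :=
  S.g.symm m X Y

theorem g_A_A (m : M) (p q : Fin 3) :
    S.g.inner m (S.A p m) (S.A q m) = if p = q then 1 else 0 := by
  have key : ∀ p, S.g.inner m (S.A p m) (S.A (p + 1) m) = 0 := fun p => by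
    have h := S.metric_J p m (S.A (p + 1) m) (S.A (p + 1) m)
    rw [S.J_A_succ, S.unit_A, S.unit_A] at h
    nlinarith
  have h0 : S.g.inner m (S.A 0 m) (S.A 1 m) = 0 := key 0
  have h1 : S.g.inner m (S.A 1 m) (S.A 2 m) = 0 := key 1
  have h2 : S.g.inner m (S.A 2 m) (S.A 0 m) = 0 := key 2
  fin_cases p <;> fin_cases q <;> simp [S.unit_A, h0, h1, h2]
  · rw [g_symm, h2]
  · rw [g_symm, h0]
  · rw [g_symm, h1]

/-- Each `J_p` is skew-symmetric: by `J_p³ = -J_p` its image is orthogonal to `A_p`, and this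
reduces skew-symmetry to the compatibility of `J_p` with the metric. -/
theorem g_J_skew (m : M) (p : Fin 3) (X Y : TangentSpace (𝓡 7) m) :
    S.g.inner m (S.J p m X) Y = -S.g.inner m X (S.J p m Y) := by
  have hA : ∀ Z, S.g.inner m (S.A p m) (S.J p m Z) = 0 := fun Z => by
    have h1 := S.J_sq p m (S.J p m Z)
    rw [S.J_sq p m Z, map_add, map_neg, map_smul, S.J_A, smul_zero, add_zero] at h1
    have h2 : S.g.inner m (S.A p m) (S.J p m Z) • S.A p m = 0 := by
      simpa using h1
    have h3 := congrArg (S.g.inner m (S.A p m)) h2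
    simpa [S.unit_A] using h3
  have h := S.metric_J p m (S.J p m X) Y
  rw [S.J_sq, hA] at h
  simp [hA] at h
  linarith

/-- The endomorphism `J_c = ∑ c_p J_p` of the tangent space, for `c ∈ ℝ³`. -/
noncomputable def Jc (c : E3) (m : M) : TangentSpace (𝓡 7) m →L[ℝ] TangentSpace (𝓡 7) m :=
  ∑ p, c p • S.J p m

theorem Jc_apply (c : E3) (m : M) (X : TangentSpace (𝓡 7) m) :
    S.Jc c m X = c 0 • S.J 0 m X + c 1 • S.J 1 m X + c 2 • S.J 2 m X := by
  simp [Jc, Fin.sum_univ_three]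

theorem reeb_apply (c : E3) (m : M) :
    S.reeb c m = c 0 • S.A 0 m + c 1 • S.A 1 m + c 2 • S.A 2 m := by
  simp [reeb, Fin.sum_univ_three]

theorem Omega_eq (c : E3) (m : M) (X Y : TangentSpace (𝓡 7) m) :
    S.Omega c m X Y = S.g.inner m (S.Jc c m X) Y := by
  simp [Omega, Jc_apply, Fin.sum_univ_three]

theorem alpha_eq (c : E3) (m : M) (X : TangentSpace (𝓡 7) m) :
    S.alpha c m X = S.g.inner m (S.reeb c m) X := by
  simp [alpha, reeb_apply, Fin.sum_univ_three]

theorem alpha_reeb (c d : E3) (m : M) : S.alpha c m (S.reeb d m) = inner ℝ c d := by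
  simp [alpha_eq, reeb_apply, g_A_A, PiLp.inner_apply, Fin.sum_univ_three]
  ring

theorem Jc_neg (c : E3) (m : M) (X : TangentSpace (𝓡 7) m) : S.Jc (-c) m X = -S.Jc c m X := by
  simp only [Jc_apply, PiLp.neg_apply]
  module

theorem Jc_zero (m : M) (X : TangentSpace (𝓡 7) m) : S.Jc 0 m X = 0 := by
  simp [Jc_apply]

theorem reeb_neg (c : E3) (m : M) : S.reeb (-c) m = -S.reeb c m := by
  simp only [reeb_apply, PiLp.neg_apply]
  module

theorem reeb_zero (m : M) : S.reeb 0 m = 0 := by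
  simp [reeb_apply]

theorem g_Jc_skew (m : M) (c : E3) (X Y : TangentSpace (𝓡 7) m) :
    S.g.inner m (S.Jc c m X) Y = -S.g.inner m X (S.Jc c m Y) := by
  simp [Jc_apply, g_J_skew]
  ring

theorem Jc_reeb (m : M) (c d : E3) : S.Jc c m (S.reeb d m) = S.reeb (cross c d) m := by
  have h01 : S.J 0 m (S.A 1 m) = S.A 2 m := S.J_A_succ 0 m
  have h12 : S.J 1 m (S.A 2 m) = S.A 0 m := S.J_A_succ 1 m
  have h20 : S.J 2 m (S.A 0 m) = S.A 1 m := S.J_A_succ 2 m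
  have h10 : S.J 1 m (S.A 0 m) = -S.A 2 m := S.J_A_pred 0 m
  have h21 : S.J 2 m (S.A 1 m) = -S.A 0 m := S.J_A_pred 1 m
  have h02 : S.J 0 m (S.A 2 m) = -S.A 1 m := S.J_A_pred 2 m
  simp only [Jc_apply, reeb_apply, map_add, map_smul, S.J_A, h01, h12, h20, h10, h21, h02]
  simp only [cross, cross_apply, Matrix.cons_val_zero, Matrix.cons_val_one, Matrix.cons_val]
  module

/-- On the orthogonal complement of the Reeb fields the `J_c` multiply as imaginary
quaternions. -/
theorem Jc_Jc (m : M) (c d : E3) {X : TangentSpace (𝓡 7) m}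
    (hX : ∀ p, S.g.inner m (S.A p m) X = 0) :
    S.Jc c m (S.Jc d m X) = S.Jc (cross c d) m X - (inner ℝ c d : ℝ) • X := by
  have h (p) : S.J p m (S.J p m X) = -X := by simp [S.J_sq, hX]
  have h01 : S.J 0 m (S.J 1 m X) = S.J 2 m X := by simpa [hX] using S.J_mul 0 m X
  have h12 : S.J 1 m (S.J 2 m X) = S.J 0 m X := by simpa [hX] using S.J_mul 1 m X
  have h20 : S.J 2 m (S.J 0 m X) = S.J 1 m X := by simpa [hX] using S.J_mul 2 m X
  have h10 : S.J 1 m (S.J 0 m X) = -S.J 2 m X := by simpa [hX] using S.J_mul' 0 m X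
  have h21 : S.J 2 m (S.J 1 m X) = -S.J 0 m X := by simpa [hX] using S.J_mul' 1 m X
  have h02 : S.J 0 m (S.J 2 m X) = -S.J 1 m X := by simpa [hX] using S.J_mul' 2 m X
  simp only [Jc_apply, map_add, map_smul, h, h01, h12, h20, h10, h21, h02]
  simp only [cross, cross_apply, PiLp.inner_apply, Fin.sum_univ_three, RCLike.inner_apply,
    Matrix.cons_val_zero, Matrix.cons_val_one, Matrix.cons_val, conj_trivial]
  module

theorem g_reeb_Jc (m : M) (c d : E3) {X : TangentSpace (𝓡 7) m}
    (hX : ∀ c, S.g.inner m (S.reeb c m) X = 0) :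
    S.g.inner m (S.reeb c m) (S.Jc d m X) = 0 := by
  rw [← neg_neg (S.g.inner m (S.reeb c m) _), ← g_Jc_skew, Jc_reeb, hX, neg_zero]

theorem g_Jc_Jc (m : M) (c d : E3) {X : TangentSpace (𝓡 7) m}
    (hX : ∀ p, S.g.inner m (S.A p m) X = 0) :
    S.g.inner m (S.Jc c m X) (S.Jc d m X) = inner ℝ c d * S.g.inner m X X := by
  have h := S.g_Jc_skew m (cross c d) X X
  rw [g_symm] at h
  rw [g_Jc_skew, Jc_Jc _ _ _ _ hX, map_sub, map_smul, smul_eq_mul]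
  linarith

omit [IsManifold (𝓡 7) ∞ M] in
theorem finrank_tangentSpace_eq (m : M) : Module.finrank ℝ (TangentSpace (𝓡 7) m) = 7 := by
  change Module.finrank ℝ (EuclideanSpace ℝ (Fin 7)) = 7
  simp

/-- Parseval's identity for seven orthonormal tangent vectors, which form a basis. -/
theorem g_expand (m : M) (f : Fin 7 → TangentSpace (𝓡 7) m)
    (hf : ∀ i k, S.g.inner m (f i) (f k) = if i = k then 1 else 0)
    (X Y : TangentSpace (𝓡 7) m) :
    S.g.inner m X Y = ∑ i, S.g.inner m (f i) X * S.g.inner m (f i) Y := by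
  have hli : LinearIndependent ℝ f := by
    rw [Fintype.linearIndependent_iff]
    intro a ha i
    have := congrArg (S.g.inner m (f i)) ha
    simpa [map_sum, hf] using this
  have hc : Fintype.card (Fin 7) = Module.finrank ℝ (TangentSpace (𝓡 7) m) := by
    rw [finrank_tangentSpace_eq, Fintype.card_fin]
  have : FiniteDimensional ℝ (TangentSpace (𝓡 7) m) :=
    FiniteDimensional.of_finrank_pos (by rw [finrank_tangentSpace_eq]; norm_num)
  have hX : X ∈ Submodule.span ℝ (Set.range f) := by
    rw [hli.span_eq_top_of_card_eq_finrank' hc]; trivial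
  obtain ⟨a, rfl⟩ := (Submodule.mem_span_range_iff_exists_fun ℝ).1 hX
  simp [map_sum, hf]

theorem exists_transverse_unit (m : M) : ∃ X : TangentSpace (𝓡 7) m,
    (∀ p, S.g.inner m (S.A p m) X = 0) ∧ S.g.inner m X X = 1 := by
  have : FiniteDimensional ℝ (TangentSpace (𝓡 7) m) :=
    FiniteDimensional.of_finrank_pos (by rw [finrank_tangentSpace_eq]; norm_num)
  let L : TangentSpace (𝓡 7) m →ₗ[ℝ] (Fin 3 → ℝ) :=
    LinearMap.pi fun p => (S.g.inner m (S.A p m) : TangentSpace (𝓡 7) m →ₗ[ℝ] ℝ)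
  have hk : LinearMap.ker L ≠ ⊥ := by
    apply LinearMap.ker_ne_bot_of_finrank_lt
    rw [finrank_tangentSpace_eq]
    simp
  obtain ⟨x, hx, hx0⟩ := Submodule.exists_mem_ne_zero_of_ne_bot hk
  have hx' : ∀ p, S.g.inner m (S.A p m) x = 0 := fun p => congrFun (LinearMap.mem_ker.1 hx) p
  have hpos : 0 < S.g.inner m x x := S.g.pos m x hx0
  have hsq := Real.mul_self_sqrt hpos.le
  have hne : √(S.g.inner m x x) ≠ 0 := (Real.sqrt_pos.2 hpos).ne'
  refine ⟨(√(S.g.inner m x x))⁻¹ • x, fun p => by simp [hx'], ?_⟩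
  simp only [map_smul, _root_.smul_apply, smul_eq_mul]
  field_simp
  linarith

/-- There is an `SO(4)`-frame over every point `[m, v]` of `Z`: for an oriented orthonormal basis
`e` of `ℝ³` with `e 0 = v` and a unit vector `x` orthogonal to the Reeb fields, take
`b = (x, -J_{e 0} x, -J_{e 1} x, J_{e 2} x)`. -/
theorem exists_SO4Frame (m : M) (v : S2) : ∃ F : S.SO4Frame m, F.e 0 = v := by
  obtain ⟨e, he, hev⟩ := exists_orientedFrame v
  obtain ⟨x, hx, hxx⟩ := S.exists_transverse_unit m
  have hr : ∀ c, S.g.inner m (S.reeb c m) x = 0 := fun c => by simp [reeb_apply, hx]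
  have hrJ : ∀ c d, S.g.inner m (S.reeb c m) (S.Jc d m x) = 0 :=
    fun c d => S.g_reeb_Jc m c d hr
  have hJr : ∀ c d, S.g.inner m (S.Jc d m x) (S.reeb c m) = 0 :=
    fun c d => by rw [g_symm, hrJ]
  have hr' : ∀ c, S.g.inner m x (S.reeb c m) = 0 := fun c => by rw [g_symm, hr]
  have hrr : ∀ i k, S.g.inner m (S.reeb (e i) m) (S.reeb (e k) m) = if i = k then 1 else 0 :=
    fun i k => by rw [← alpha_eq, alpha_reeb, he.inner_eq]
  have hJJ : ∀ i k, S.g.inner m (S.Jc (e i) m x) (S.Jc (e k) m x) = if i = k then 1 else 0 :=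
    fun i k => by rw [S.g_Jc_Jc m _ _ hx, he.inner_eq, hxx, mul_one]
  have hxJ : ∀ c, S.g.inner m x (S.Jc c m x) = 0 := fun c => by
    have h := S.g_Jc_skew m c x x
    rw [g_symm] at h
    linarith
  have hJx : ∀ c, S.g.inner m (S.Jc c m x) x = 0 := fun c => by rw [g_symm, hxJ]
  -- the `A_{e i}` together with `b` are orthonormal, so that `g` can be expanded in them
  have hf := S.g_expand m
    ![S.reeb (e 0) m, S.reeb (e 1) m, S.reeb (e 2) m, x, -S.Jc (e 0) m x, -S.Jc (e 1) m x,
      S.Jc (e 2) m x] (by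
    intro i k
    fin_cases i <;> fin_cases k <;>
      simp [hrr, hJJ, hxJ, hJx, hr, hr', hrJ, hJr, hxx])
  have h10 : cross (e 1) (e 0) = -e 2 := by rw [cross_swap, he.cross_zero_one]
  have h20 : cross (e 2) (e 0) = e 1 := by rw [cross_swap, he.cross_zero_two, neg_neg]
  have h21 : cross (e 2) (e 1) = -e 0 := by rw [cross_swap, he.cross_one_two]
  -- expand `g (J_c X) Y = ∑ g (f i) (J_c X) * g (f i) Y` and move `J_c` to `f i`
  -- in the expansion of `g (J_c X) Y`, moves `J_c` from `X` to the frame vectors, where the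
  -- multiplication rules evaluate it
  have hmove : ∀ c X Y, S.g.inner m Y (S.Jc c m X) = -S.g.inner m (S.Jc c m Y) X :=
    fun c X Y => by rw [g_Jc_skew, neg_neg]
  refine ⟨⟨e, ![x, -S.Jc (e 0) m x, -S.Jc (e 1) m x, S.Jc (e 2) m x], he, ?_, ?_, ?_, ?_, ?_⟩,
    hev⟩
  · intro i k
    fin_cases i <;> fin_cases k <;> simp [hJJ, hxJ, hJx, hxx]
  · intro i p
    have hA : S.A p m = S.reeb (EuclideanSpace.single p 1) m := by
      fin_cases p <;> simp [reeb_apply]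
    rw [hA]
    fin_cases i <;> simp [hr, hrJ]
  all_goals
    intro X Y
    rw [Omega_eq, hf]
    simp only [Fin.sum_univ_seven, Matrix.cons_val_zero, Matrix.cons_val_one, Matrix.cons_val,
      hmove]
    simp [S.Jc_Jc m _ _ hx, Jc_reeb, cross_self_zero, he.cross_zero_one, he.cross_zero_two,
      he.cross_one_two, h10, h20, h21, he.inner_eq, he.1.norm_eq_one, Jc_neg, Jc_zero, reeb_neg, reeb_zero,
      alpha_eq]
    ring

end Structure

/-! ### Horizontal vectors and pseudo-holomorphic curves -/

open Structure in
/-- `π_4 = ζ_2 + i ζ_3` is of type `(1,0)` for the complex structure `η ↦ w × η` of `S²`, where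
`w = h 0`. -/
theorem OrientedFrame.zeta_cross {h : Fin 3 → E3} (hh : OrientedFrame h) (η : E3) :
    zeta h (cross (h 0) η) = (-(zeta h η).2, (zeta h η).1) := by
  have h1 : inner ℝ (cross (h 0) η) (h 1) = -inner ℝ η (h 2) := by
    rw [inner_cross_right, hh.cross_zero_one]
  have h2 : inner ℝ (cross (h 0) η) (h 2) = inner ℝ η (h 1) := by
    rw [inner_cross_right, hh.cross_zero_two, inner_neg_right, neg_neg]
  simp only [zeta, h1, h2, neg_neg, neg_div]

namespace Structure

variable {M : Type*} [TopologicalSpace M] [ChartedSpace (EuclideanSpace ℝ (Fin 7)) M]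
  [IsManifold (𝓡 7) ∞ M] {S : Structure M}

theorem contMDiff_coe_S2 : ContMDiff (𝓡 2) 𝓘(ℝ, E3) 1 (fun x : S2 => (x : E3)) :=
  -- the charts of `S2` are those of the sphere in an inner product space of dimension `2 + 1`
  have : Fact (Module.finrank ℝ E3 = 2 + 1) := ⟨finrank_euclideanSpace_fin⟩
  contMDiff_coe_sphere

/-- A derivative of a map to `S²` is tangent to `S²`. -/
theorem sphereDeriv_orthogonal {C : Type*} [TopologicalSpace C]
    [ChartedSpace (EuclideanSpace ℝ (Fin 2)) C] {v : C → S2} {s : C}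
    (hv : MDifferentiableAt (𝓡 2) (𝓡 2) v s) (ξ : TangentSpace (𝓡 2) s) :
    inner ℝ (v s : E3) (sphereDeriv v s ξ) = 0 := by
  have hd : MDifferentiableAt (𝓡 2) 𝓘(ℝ, E3) (fun x => (v x : E3)) s :=
    (contMDiff_coe_S2.mdifferentiableAt one_ne_zero).comp s hv
  have hq : HasMFDerivAt 𝓘(ℝ, E3) 𝓘(ℝ, ℝ) (fun y : E3 => ‖y‖ ^ 2) (v s : E3)
      (2 • innerSL ℝ (v s : E3)) :=
    (hasStrictFDerivAt_norm_sq (v s : E3)).hasFDerivAt.hasMFDerivAt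
  have hcomp := (hq.comp s hd.hasMFDerivAt).mfderiv
  have hconst : (fun y : E3 => ‖y‖ ^ 2) ∘ (fun x => (v x : E3)) = fun _ => (1 : ℝ) := by
    funext x
    simp
  rw [hconst, mfderiv_const] at hcomp
  have h : (0 : ℝ) = 2 • inner ℝ (v s : E3) (sphereDeriv v s ξ) :=
    congrArg (fun L => L ξ) hcomp
  simpa using h.symm

theorem SO4Frame.reeb_transverse {m : M} (F : S.SO4Frame m) (c : E3) (i : Fin 4) :
    S.g.inner m (F.b i) (S.reeb c m) = 0 := by
  rw [g_symm]
  simp [reeb_apply, F.transverse]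

/-- The nearly Kähler product with the vertical vector `(A_c, 0)` only sees the form `π_1`, as the
`β_k` vanish on the Reeb fields. -/
theorem nkMetric_reeb {m : M} (F : S.SO4Frame m) (t : TangentSpace (𝓡 7) m × E3) (c : E3) :
    nkMetric F t (S.reeb c m, 0) =
      (alphaTwoThree F F.e t.1 t.2 0).1 * inner ℝ (F.e 1) c +
        (alphaTwoThree F F.e t.1 t.2 0).2 * inner ℝ (F.e 2) c := by
  simp [nkMetric, Fin.sum_univ_three, piForm, alphaTwoThree, zeta, F.reeb_transverse,
    Structure.alpha_reeb]

/-- A vector of `Z` is horizontal only if it is annihilated by the restrictions to `Z × {w}` of the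
forms `α_2` and `α_3`: pair it with the vertical vectors `(A_{e 1}, 0)` and `(A_{e 2}, 0)`. -/
theorem IsHorizontalVector.alpha_add_zeta {m : M} {v : S2} {t : TangentSpace (𝓡 7) m × E3}
    (ht : S.IsHorizontalVector m v t) (F : S.SO4Frame m) (hF : F.e 0 = v) :
    S.alpha (F.e 1) m t.1 + (zeta F.e t.2).1 = 0 ∧
      S.alpha (F.e 2) m t.1 + (zeta F.e t.2).2 = 0 := by
  have h1 := ht F hF (S.reeb (F.e 1) m, 0) (by simp) ⟨_, rfl⟩
  have h2 := ht F hF (S.reeb (F.e 2) m, 0) (by simp) ⟨_, rfl⟩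
  rw [nkMetric_reeb] at h1 h2
  constructor
  · simpa [alphaTwoThree, zeta, F.oriented.inner_eq, F.oriented.1.norm_eq_one] using h1
  · simpa [alphaTwoThree, zeta, F.oriented.inner_eq, F.oriented.1.norm_eq_one] using h2

/-- The horizontal and the vertical subspace of `T Z` intersect trivially: if `X = A_c`, then the
vanishing of `α_2` and `α_3` on `(X, ν)` determines the components of `ν` orthogonal to `v` and
gives `ν = 2 c × v`, so that `(X, ν)` is tangent to the `Sp(1)`-orbit. -/
theorem IsHorizontalVector.isZeroZ {m : M} {v : S2} {t : TangentSpace (𝓡 7) m × E3}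
    (ht : S.IsHorizontalVector m v t) (hν : inner ℝ (v : E3) t.2 = 0)
    (hvert : S.IsVertical m t.1) : S.IsZeroZ m v t := by
  obtain ⟨F, hF⟩ := S.exists_SO4Frame m v
  obtain ⟨h1, h2⟩ := ht.alpha_add_zeta F hF
  obtain ⟨c, hc⟩ := hvert
  refine ⟨c, hc, F.oriented.ext_inner fun i => ?_⟩
  rw [hc, Structure.alpha_reeb] at h1 h2
  simp only [zeta] at h1 h2
  have c1 : inner ℝ (F.e 1) (cross c v) = inner ℝ (F.e 2) c := by
    rw [← hF, real_inner_comm, cross_swap, inner_neg_left, inner_cross_right,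
      F.oriented.cross_zero_one, neg_neg, real_inner_comm]
  have c2 : inner ℝ (F.e 2) (cross c v) = -inner ℝ (F.e 1) c := by
    rw [← hF, real_inner_comm, cross_swap, inner_neg_left, inner_cross_right,
      F.oriented.cross_zero_two, inner_neg_right, neg_neg, real_inner_comm]
  have c0 : inner ℝ (F.e 0) (cross c v) = 0 := by
    rw [hF, cross_swap, inner_neg_right, inner_cross_self, neg_zero]
  rw [inner_smul_right]
  fin_cases i
  · simp only [Fin.zero_eta, c0]
    rw [hF, hν, mul_zero]
  · simp only [Fin.mk_one, c1]
    rw [real_inner_comm]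
    linarith
  · simp only [Fin.reduceFinMk, c2]
    rw [real_inner_comm]
    linarith

/-- If `t'` is the image of `t` under the almost complex structure of `Z` and both are horizontal,
then `(t', w × η)` is the image of `(t, η)` under `J`. -/
theorem NKImage.jImage {m : M} {v w : S2} {t t' : TangentSpace (𝓡 7) m × E3}
    (h : S.NKImage m v t t') (ht : S.IsHorizontalVector m v t)
    (ht' : S.IsHorizontalVector m v t') (a b : ℝ) (η : E3) :
    S.JImage a b m v w (t.1, t.2, η) (t'.1, t'.2, cross w η) := by
  intro F f hF hf hfw k
  obtain ⟨h1, h2⟩ := ht.alpha_add_zeta F hF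
  obtain ⟨h1', h2'⟩ := ht'.alpha_add_zeta F hF
  have hζ := hf.zeta_cross η
  rw [hfw] at hζ
  have hnk := h w F f hF hf hfw
  have hI := Complex.I_mul_I
  fin_cases k
  -- on horizontal vectors `π_1 = -a π_4`; on all vectors `π_2`, `π_3` are `b` times the
  -- corresponding forms of `Z`
  · simp [piForm, alphaTwoThree, h1, h2, h1', h2', hζ]
    linear_combination (a * (zeta f η).2 : ℂ) * hI
  · have := hnk 1
    simp [piForm] at this ⊢
    linear_combination (b : ℂ) * this
  · have := hnk 2
    simp [piForm] at this ⊢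
    linear_combination (b : ℂ) * this
  · simp [piForm, hζ]
    linear_combination -((zeta f η).2 : ℂ) * hI

end Structure
end ThreeSasaki

theorem proposition4p8 {M : Type*} [TopologicalSpace M]
    [ChartedSpace (EuclideanSpace ℝ (Fin 7)) M] [IsManifold (𝓡 7) ∞ M] [T2Space M] [CompactSpace M]
    (S : ThreeSasaki.Structure M) (a b : ℝ) (ha : 0 < a) (hb : 0 < b)
    {C : Type*} [TopologicalSpace C] [ChartedSpace (EuclideanSpace ℝ (Fin 2)) C]
    [IsManifold (𝓡 2) ∞ C]
    (f : C → S.TwistorSpace)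
    (hf : S.IsImmersedPseudoholomorphicCurve f) (hf_hor : S.IsHorizontal f)
    (j : ∀ s : C, TangentSpace (𝓡 2) s →L[ℝ] TangentSpace (𝓡 2) s)
    (hj : S.IsInducedComplexStructure f j)
    (w : C → ThreeSasaki.S2) (hw : ThreeSasaki.Structure.IsHolomorphicToSphere j w) :
    S.IsJHolomorphicCurve a b (fun s => (f s, w s)) ∧
      S.NowhereTangentToFibers (fun s => (f s, w s)) := by
  refine ⟨⟨hf.1.1, hw.1, fun U Φ v hL s hs ξ => ⟨fun h => hf.1.2 U Φ v hL s hs ξ h.1, j s ξ, ?_⟩⟩,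
    fun U Φ v hL s hs ξ hξ => hf.1.2 U Φ v hL s hs ξ ?_⟩
  · dsimp only
    rw [hw.2]
    exact (hj U Φ v hL s hs ξ).jImage (hf_hor U Φ v hL s hs ξ) (hf_hor U Φ v hL s hs (j s ξ)) a b _
  · have hv : MDifferentiableAt (𝓡 2) (𝓡 2) v s :=
      (hL.2.2.1.contMDiffAt (hL.1.mem_nhds hs)).mdifferentiableAt (by simp)
    exact (hf_hor U Φ v hL s hs ξ).isZeroZ
      (ThreeSasaki.Structure.sphereDeriv_orthogonal hv ξ) hξ
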